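/- Let $p$ be a prime, let $g\ge 1$, and let $\rho\colon \mathbb{P}^{g-1}(\mathbb{Q}_p)\to\mathbb{P}^{g-1}(\mathbb{F}_p)$ be the reduction map (choose homogeneous coordinates in $\mathbb{Z}_p$, not all divisible by $p$, and reduce them modulo $p$). For a subset $S\subseteq\mathbb{Q}_p^g$, write $\rho(S)$ for the set of reductions of the points of $\mathbb{P}^{g-1}(\mathbb{Q}_p)$ represented by the nonzero elements of $S$. Let $v_p$ be the $p$-adic valuation with $v_p(p)=1$. Let $\mathbf{w}=(w_1,\dots,w_g)\in\mathbb{Q}_p[[t]]^g\setminus\{\mathbf{0}\}$ have $p$-adically bounded coefficients, and let $w_{j,n}$ be the coefficient of $t^n$ in $w_j$. The Newton polygon of $\mathbf{w}$ is the lower convex hull of the set of points $(n,v_p(w_{j,n}))$ for $1\le j\le g$, $n\ge 0$, $w_{j,n}\ne 0$. Let $n_{\mathbf{w}}$ be the smallest $x$-coordinate among those vertices of the Newton polygon whose $y$-coordinate is minimal among all vertices. For $n\ge 0$ let \[ \delta(p,n)=\max\{d\in\mathbb{Z}_{\ge 0} : v_p(n+1)+d\le v_p(n+d+1)\}. \]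 Proposition. Let $\boldsymbol\ell\in\mathbb{Q}_p[[t]]^g$ be such that $d\boldsymbol\ell/dt=\mathbf{w}$. Then the minimum defining $n_{\mathbf{w}}$ exists, the series $\boldsymbol\ell$ converges on $p\mathbb{Z}_p$, and \[ \#\rho\bigl(\boldsymbol\ell(p\mathbb{Z}_p)\bigr)\le p\,\bigl(n_{\mathbf{w}}+1+\delta(p,n_{\mathbf{w}})\bigr)+1. \] -/

import Mathlib

open scoped LinearAlgebra.Projectivization

noncomputable section

namespace PadicCurve

variable {p : ℕ} [Fact p.Prime] {g : ℕ}

/-! ### Reduction of projective points -/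

/-- Coordinatewise reduction `ℤ_p^g → 𝔽_p^g`. -/
def residueVec (y : Fin g → ℤ_[p]) : Fin g → ZMod p :=
  fun i => PadicInt.toZMod (y i)

/-- `y ∈ ℤ_p^g` is a vector of primitive homogeneous coordinates for the point of
`ℙ^{g-1}(ℚ_p)` represented by `x`. -/
def IsPrimitiveRep (x : Fin g → ℚ_[p]) (y : Fin g → ℤ_[p]) : Prop :=
  (∃ c : ℚ_[p], c ≠ 0 ∧ ∀ i, ((y i : ℤ_[p]) : ℚ_[p]) = c * x i) ∧ residueVec y ≠ 0

theorem exists_isPrimitiveRep {x : Fin g → ℚ_[p]} (hx : x ≠ 0) :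
    ∃ y, IsPrimitiveRep x y := by
  obtain ⟨j, hj⟩ := Function.ne_iff.mp hx
  obtain ⟨k, -, hk⟩ := Finset.exists_max_image Finset.univ (fun i => ‖x i‖) ⟨j, Finset.mem_univ j⟩
  have hk0 : x k ≠ 0 := by
    intro h
    have := hk j (Finset.mem_univ j)
    rw [h, norm_zero] at this
    exact hj (norm_le_zero_iff.mp this)
  have hle : ∀ i, ‖(x k)⁻¹ * x i‖ ≤ 1 := by
    intro i
    rw [norm_mul, norm_inv, inv_mul_le_iff₀ (norm_pos_iff.mpr hk0), mul_one]
    exact hk i (Finset.mem_univ i)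
  have hz : ∀ i, ∃ z : ℤ_[p], (z : ℚ_[p]) = (x k)⁻¹ * x i := fun i => ⟨⟨_, hle i⟩, rfl⟩
  choose z hz using hz
  refine ⟨z, ⟨(x k)⁻¹, inv_ne_zero hk0, hz⟩, ?_⟩
  intro h
  have h1 := congrFun h k
  have h2 : z k = 1 := by
    apply PadicInt.ext
    rw [hz k, inv_mul_cancel₀ hk0, PadicInt.coe_one]
  rw [residueVec, h2, map_one, Pi.zero_apply] at h1
  exact one_ne_zero h1

theorem residueVec_ne_zero_iff {y : Fin g → ℤ_[p]} :
    residueVec y ≠ 0 ↔ ∃ i, ‖y i‖ = 1 := by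
  rw [Function.ne_iff]
  refine exists_congr fun i => ?_
  rw [← PadicInt.isUnit_iff, residueVec, Pi.zero_apply, ne_eq, ← RingHom.mem_ker,
    PadicInt.ker_toZMod, IsLocalRing.mem_maximalIdeal, mem_nonunits_iff, not_not]

/-- Two vectors of primitive coordinates of the same point have proportional reductions. -/
theorem mk_residueVec_eq {x x' : Fin g → ℚ_[p]} {y y' : Fin g → ℤ_[p]} {t : ℚ_[p]}
    (hx : x ≠ 0) (hxx' : x = t • x') (h : IsPrimitiveRep x y) (h' : IsPrimitiveRep x' y') :
    Projectivization.mk (ZMod p) (residueVec y) h.2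
      = Projectivization.mk (ZMod p) (residueVec y') h'.2 := by
  obtain ⟨⟨c, hc, hy⟩, hr⟩ := h
  obtain ⟨⟨c', hc', hy'⟩, hr'⟩ := h'
  obtain ⟨i, hi⟩ := residueVec_ne_zero_iff.mp hr
  obtain ⟨j, hj⟩ := residueVec_ne_zero_iff.mp hr'
  have ht : t ≠ 0 := by
    rintro rfl
    exact hx (by rw [hxx', zero_smul])
  set u : ℚ_[p] := c * t * c'⁻¹ with hu
  have key : ∀ k, ((y k : ℤ_[p]) : ℚ_[p]) = u * (y' k : ℚ_[p]) := by
    intro k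
    rw [hy, hy', hxx', hu, Pi.smul_apply, smul_eq_mul]
    field_simp
  have hn : ‖u‖ ≤ 1 := by
    have h1 := congrArg norm (key j)
    rw [norm_mul, ← PadicInt.norm_def, ← PadicInt.norm_def, hj, mul_one] at h1
    rw [← h1]
    exact PadicInt.norm_le_one _
  obtain ⟨z, hz⟩ : ∃ z : ℤ_[p], (z : ℚ_[p]) = u := ⟨⟨u, hn⟩, rfl⟩
  rw [Projectivization.mk_eq_mk_iff']
  refine ⟨PadicInt.toZMod z, ?_⟩
  funext k
  have h2 : y k = z * y' k := by
    apply PadicInt.ext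
    rw [key k, PadicInt.coe_mul, hz]
  simp only [Pi.smul_apply, residueVec, smul_eq_mul]
  rw [h2, map_mul]

/-- The reduction map `ρ : ℙ^{g-1}(ℚ_p) → ℙ^{g-1}(𝔽_p)`: reduce primitive homogeneous
coordinates modulo `p`. -/
def rho : ℙ ℚ_[p] (Fin g → ℚ_[p]) → ℙ (ZMod p) (Fin g → ZMod p) :=
  Projectivization.lift
    (fun v => Projectivization.mk (ZMod p) (residueVec (exists_isPrimitiveRep v.2).choose)
      (exists_isPrimitiveRep v.2).choose_spec.2)
    (fun a b _ h => mk_residueVec_eq a.2 h (exists_isPrimitiveRep a.2).choose_spec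
      (exists_isPrimitiveRep b.2).choose_spec)

/-- `ρ` can be computed with any vector of primitive coordinates. -/
theorem rho_mk {x : Fin g → ℚ_[p]} (hx : x ≠ 0) {y : Fin g → ℤ_[p]} (h : IsPrimitiveRep x y) :
    rho (Projectivization.mk ℚ_[p] x hx) = Projectivization.mk (ZMod p) (residueVec y) h.2 :=
  mk_residueVec_eq hx (one_smul _ x).symm (exists_isPrimitiveRep hx).choose_spec h

/-- `ρ(S)` for a subset `S` of `ℚ_p^g`: the set of reductions of the nonzero elements of `S`. -/
def rhoImage (S : Set (Fin g → ℚ_[p])) : Set (ℙ (ZMod p) (Fin g → ZMod p)) :=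
  {P | ∃ x ∈ S, ∃ hx : x ≠ 0, rho (Projectivization.mk ℚ_[p] x hx) = P}

/-! ### Power series on `pℤ_p` -/

variable (p) in
/-- The disk `pℤ_p`, as a subset of `ℚ_p`. -/
def pZp : Set ℚ_[p] := {τ | ∃ a : ℤ_[p], τ = (p : ℚ_[p]) * (a : ℚ_[p])}

/-- The value at `τ` of a tuple of power series. -/
def evalSeries (f : Fin g → PowerSeries ℚ_[p]) (τ : ℚ_[p]) : Fin g → ℚ_[p] :=
  fun i => ∑' n : ℕ, PowerSeries.coeff n (f i) * τ ^ n

/-! ### The Newton polygon -/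

/-- The points `(n, v_p(w_{j,n}))`; zero coefficients, of valuation `∞`, contribute no point. -/
def newtonPoints (w : Fin g → PowerSeries ℚ_[p]) : Set (ℝ × ℝ) :=
  {P | ∃ (j : Fin g) (n : ℕ), PowerSeries.coeff n (w j) ≠ 0 ∧
    P = ((n : ℝ), ((PowerSeries.coeff n (w j)).valuation : ℝ))}

/-- The region on and above the Newton polygon: the convex hull of the vertical upward rays
that start at the points `(n, v_p(w_{j,n}))`. -/
def newtonRegion (w : Fin g → PowerSeries ℚ_[p]) : Set (ℝ × ℝ) :=
  convexHull ℝ {Q | ∃ P ∈ newtonPoints w, Q.1 = P.1 ∧ P.2 ≤ Q.2}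

/-- The vertices of the Newton polygon. -/
def newtonVertices (w : Fin g → PowerSeries ℚ_[p]) : Set (ℝ × ℝ) :=
  Set.extremePoints ℝ (newtonRegion w)

/-- The `x`-coordinates of the vertices of the Newton polygon whose `y`-coordinate is minimal
among all vertices. -/
def lowestAbscissae (w : Fin g → PowerSeries ℚ_[p]) : Set ℕ :=
  {n | ∃ y : ℝ, ((n : ℝ), y) ∈ newtonVertices w ∧ ∀ Q ∈ newtonVertices w, y ≤ Q.2}

/-- The number `n_w`: the smallest `x`-coordinate of a lowest vertex. -/
def newtonMin (w : Fin g → PowerSeries ℚ_[p]) : ℕ := sInf (lowestAbscissae w)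

/-! ### The correction term -/

/-- `δ(p, n) = max {d ≥ 0 : v_p(n + 1) + d ≤ v_p(n + d + 1)}`. -/
def delta (p n : ℕ) : ℕ :=
  sSup {d : ℕ | padicValNat p (n + 1) + d ≤ padicValNat p (n + d + 1)}

/-- The maximum in the definition of `δ(p, n)` is attained. -/
theorem delta_isGreatest (p : ℕ) [Fact p.Prime] (n : ℕ) :
    IsGreatest {d : ℕ | padicValNat p (n + 1) + d ≤ padicValNat p (n + d + 1)} (delta p n) := by
  have hb : BddAbove {d : ℕ | padicValNat p (n + 1) + d ≤ padicValNat p (n + d + 1)} := by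
    refine ⟨n + 2, fun d hd => ?_⟩
    by_contra! hlt
    have hd' : d ≤ padicValNat p (n + d + 1) := le_trans (Nat.le_add_left _ _) hd
    have h1 : p ^ d ∣ n + d + 1 := (pow_dvd_pow p hd').trans pow_padicValNat_dvd
    have h2 : p ^ d ≤ n + d + 1 := Nat.le_of_dvd (by omega) h1
    have h3 : 2 ^ d ≤ p ^ d := Nat.pow_le_pow_left (Fact.out : p.Prime).two_le d
    obtain ⟨e, rfl⟩ : ∃ e, d = e + 1 := ⟨d - 1, by omega⟩
    have h4 : e < 2 ^ e := Nat.lt_two_pow_self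
    rw [pow_succ 2 e] at h3
    omega
  exact ⟨Nat.sSup_mem ⟨0, by simp⟩ hb, fun d hd => le_csSup hb hd⟩

end PadicCurve

end

/-!
Substituting `τ = p t` turns `ℓ` into a vector of power series in `t` converging on `ℤ_p`. Since
`ρ` is locally constant away from `0` and `ℙ^{g-1}(𝔽_p)` is finite, only finitely many values of `t`
matter, and `ℓ(p t)` may be replaced by a truncation, that is by a polynomial vector, which is then
scaled to be primitive (integral and nonzero modulo `p`).

For a primitive polynomial vector `F` whose reduction has degree `N`, the values of `F` on `ℤ_p` have
at most `p N + 1` reductions, even with the reduction of the coefficient vector of degree `N` (the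
point of the reduced curve at infinity) included: this is `ncard_insert_top_rhoImage_le`. Write
`F mod p = ∏ (X - a)^{m_a} * v` with `v` without zeros in `𝔽_p`. Restricted to the residue disk
of `a` and rescaled to be primitive again, `F` has reduced degree at most `m_a`, and in case of
equality its point at infinity is `[v(a)]` (`exists_primitive_on_residue_disk`). By induction each
residue disk contributes at most `p m_a` points other than `[v(a)]`. If `v` is not constant, then
`∑ m_a < N`, which leaves room for the at most `p` points `[v(a)]` and the point at infinity; if `v`
is constant, then all the `[v(a)]` are equal to the point at infinity. The induction terminates
because finitely many parameters are separated by some power of `p`.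

It remains to bound `N`. The lowest vertices of the Newton polygon come from coefficients of minimal
valuation (`lowestAbscissae_spec`). The coefficient of `t^{n+1}` in `ℓ(p t)` is
`w_n p^{n+1} / (n+1)`, and by the definition of `δ` the one with `n = n_w` dominates all those with
`n > n_w + δ(p, n_w)` (`norm_pow_div_lt`). Hence `N ≤ n_w + 1 + δ(p, n_w)`.
-/

noncomputable section

namespace PadicCurve

open Polynomial

/-! ### Reduction of vectors -/

section Reduction

variable {p : ℕ} [Fact p.Prime] {g : ℕ}

/-- The inclusion `ℤ_p^g → ℚ_p^g`. -/
def coeVec (y : Fin g → ℤ_[p]) : Fin g → ℚ_[p] := fun i => (y i : ℚ_[p])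

theorem isPrimitiveRep_coeVec {y : Fin g → ℤ_[p]} (hy : residueVec y ≠ 0) :
    IsPrimitiveRep (coeVec y) y :=
  ⟨⟨1, one_ne_zero, fun i => (one_mul ((y i : ℤ_[p]) : ℚ_[p])).symm⟩, hy⟩

theorem IsPrimitiveRep.ne_zero {x : Fin g → ℚ_[p]} {y : Fin g → ℤ_[p]}
    (h : IsPrimitiveRep x y) : x ≠ 0 := by
  rintro rfl
  obtain ⟨⟨c, -, hy⟩, hr⟩ := h
  refine hr (funext fun i => ?_)
  have : y i = 0 := PadicInt.ext (by rw [hy i]; simp)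
  simp [residueVec, this]

theorem rhoImage_subset_of_smul {S S' : Set (Fin g → ℚ_[p])} {c : ℚ_[p]} (hc : c ≠ 0)
    (h : ∀ x ∈ S, ∃ x' ∈ S', x = c • x') : rhoImage S ⊆ rhoImage S' := by
  rintro P ⟨x, hx, hx0, rfl⟩
  obtain ⟨x', hx', rfl⟩ := h x hx
  have hx0' : x' ≠ 0 := by
    rintro rfl
    exact hx0 (smul_zero c)
  refine ⟨x', hx', hx0', ?_⟩
  congr 1
  rw [Projectivization.mk_eq_mk_iff']
  exact ⟨c⁻¹, inv_smul_smul₀ hc x'⟩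

theorem toZMod_eq_zero_iff {z : ℤ_[p]} : PadicInt.toZMod z = 0 ↔ ‖z‖ < 1 := by
  rw [← RingHom.mem_ker, PadicInt.ker_toZMod, IsLocalRing.mem_maximalIdeal,
    PadicInt.mem_nonunits]

/-- The reduction map is locally constant. -/
theorem exists_rho_eq_of_close {x x' : Fin g → ℚ_[p]} (hx : x ≠ 0)
    (h : ∃ i, ∀ j, ‖x' j - x j‖ < ‖x i‖) :
    ∃ hx' : x' ≠ 0, rho (Projectivization.mk ℚ_[p] x' hx')
      = rho (Projectivization.mk ℚ_[p] x hx) := by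
  obtain ⟨y, hy⟩ := exists_isPrimitiveRep hx
  obtain ⟨⟨c, hc, hcy⟩, hr⟩ := id hy
  obtain ⟨i, hi⟩ := h
  have hsmall : ∀ j, ‖c * (x' j - x j)‖ < 1 := by
    intro j
    calc ‖c * (x' j - x j)‖ = ‖c‖ * ‖x' j - x j‖ := norm_mul _ _
      _ < ‖c‖ * ‖x i‖ := mul_lt_mul_of_pos_left (hi j) (norm_pos_iff.mpr hc)
      _ = ‖y i‖ := by rw [← norm_mul, ← hcy i, PadicInt.norm_def]
      _ ≤ 1 := PadicInt.norm_le_one _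
  have hz : ∀ j, ∃ z : ℤ_[p], (z : ℚ_[p]) = c * (x' j - x j) :=
    fun j => ⟨⟨_, (hsmall j).le⟩, rfl⟩
  choose z hz using hz
  have hres : residueVec (fun j => y j + z j) = residueVec y := by
    funext j
    have : PadicInt.toZMod (z j) = 0 := by
      rw [toZMod_eq_zero_iff, PadicInt.norm_def, hz j]
      exact hsmall j
    simp only [residueVec, map_add, this, add_zero]
  have hrep : IsPrimitiveRep x' (fun j => y j + z j) := by
    refine ⟨⟨c, hc, fun j => ?_⟩, hres ▸ hr⟩
    rw [PadicInt.coe_add, hcy j, hz j]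
    ring
  refine ⟨hrep.ne_zero, ?_⟩
  rw [rho_mk hrep.ne_zero hrep, rho_mk hx hy]
  congr 1

end Reduction

/-! ### Splitting off common roots -/

/-- A nonzero vector of polynomials over a field is a product of linear factors times a vector of
polynomials without a common root in the field. -/
theorem exists_eq_prod_X_sub_C_mul {K ι : Type*} [Field K] (u : ι → K[X]) (hu : u ≠ 0) :
    ∃ (s : Multiset K) (v : ι → K[X]),
      (∀ i, u i = (s.map fun a => X - C a).prod * v i) ∧ ∀ a, ∃ i, (v i).eval a ≠ 0 := by
  obtain ⟨j, hj⟩ := Function.ne_iff.mp hu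
  induction hn : (u j).natDegree using Nat.strong_induction_on generalizing u with
  | _ n ih =>
    by_cases hroot : ∀ a, ∃ i, (u i).eval a ≠ 0
    · exact ⟨0, u, by simp, hroot⟩
    push Not at hroot
    obtain ⟨a, ha⟩ := hroot
    have hdvd : ∀ i, ∃ q, u i = (X - C a) * q := fun i => dvd_iff_isRoot.mpr (ha i)
    choose u' hu' using hdvd
    have hj' : u' j ≠ 0 := by
      intro h
      exact hj (by rw [hu' j, h, mul_zero, Pi.zero_apply])
    have hdeg : (u' j).natDegree < n := by
      rw [← hn, hu' j, natDegree_mul (X_sub_C_ne_zero a) hj', natDegree_X_sub_C]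
      omega
    obtain ⟨s, v, hs, hv⟩ := ih _ hdeg u' (Function.ne_iff.mpr ⟨j, hj'⟩) hj' rfl
    refine ⟨a ::ₘ s, v, fun i => ?_, hv⟩
    rw [hu' i, hs i, Multiset.map_cons, Multiset.prod_cons, mul_assoc]

/-- Near a point `a` of multiplicity `m` in `s`, the product `∏ (X - b) * v` begins with a nonzero
multiple of `v(a)` in degree `m`. -/
theorem exists_coeff_taylor_prod_X_sub_C_mul {K : Type*} [Field K] [DecidableEq K]
    (s : Multiset K) (a : K) :
    ∃ c : K, c ≠ 0 ∧ ∀ v : K[X],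
      (taylor a ((s.map fun b => X - C b).prod * v)).coeff (s.count a) = c * v.eval a := by
  set r := (s.filter (a ≠ ·)).map fun b => X - C b with hr
  refine ⟨r.prod.eval a, ?_, fun v => ?_⟩
  · rw [eval_multiset_prod, hr, Multiset.map_map]
    simp [Multiset.prod_eq_zero_iff, sub_eq_zero]
  · have hprod : (s.map fun b => X - C b).prod = (X - C a) ^ s.count a * r.prod := by
      rw [hr, ← Multiset.filter_add_not (a = ·) s, Multiset.map_add, Multiset.prod_add]
      congr 2
      · rw [Multiset.filter_eq, Multiset.map_replicate, Multiset.prod_replicate]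
        simp
      · simp
    rw [hprod, mul_assoc, taylor_mul, taylor_pow]
    have : taylor a (X - C a) = X := by simp
    rw [this, coeff_X_pow_mul', if_pos le_rfl, Nat.sub_self, taylor_coeff_zero, eval_mul]

/-! ### Primitive polynomial vectors -/

section Primitive

variable {p : ℕ} [Fact p.Prime] {g : ℕ}

/-- The vector of coefficients of degree `n`. -/
def coeffVec {R : Type*} [Semiring R] (F : Fin g → R[X]) (n : ℕ) : Fin g → R :=
  fun i => (F i).coeff n

/-- The value of an integral polynomial vector, as an element of `ℚ_p^g`. -/
def evalVec (F : Fin g → ℤ_[p][X]) (t : ℤ_[p]) : Fin g → ℚ_[p] :=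
  coeVec fun i => (F i).eval t

/-- `N` is the degree of the reduction modulo `p` of the polynomial vector `F`, which is
nonzero. -/
structure HasReducedDegree (F : Fin g → ℤ_[p][X]) (N : ℕ) : Prop where
  ne_zero : residueVec (coeffVec F N) ≠ 0
  eq_zero : ∀ n, N < n → residueVec (coeffVec F n) = 0

/-- The reduction of the leading coefficient vector of `F` modulo `p`: this is the limit of
the reduced curve at infinity. -/
def HasReducedDegree.top {F : Fin g → ℤ_[p][X]} {N : ℕ} (h : HasReducedDegree F N) :
    ℙ (ZMod p) (Fin g → ZMod p) :=
  Projectivization.mk (ZMod p) (residueVec (coeffVec F N)) h.ne_zero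

/-- A nonzero polynomial vector over `ℚ_p` is a scalar multiple of a primitive integral one. -/
theorem exists_primitive (G : Fin g → ℚ_[p][X]) (hG : G ≠ 0) :
    ∃ (c : ℚ_[p]) (F : Fin g → ℤ_[p][X]) (N : ℕ), c ≠ 0 ∧
      (∀ i n, (G i).coeff n = c * ((F i).coeff n : ℤ_[p])) ∧
      (∀ i (t : ℤ_[p]), (G i).eval (t : ℚ_[p]) = c * ((F i).eval t : ℤ_[p])) ∧
      HasReducedDegree F N := by
  obtain ⟨j, hj⟩ := Function.ne_iff.mp hG
  obtain ⟨n₀, hn₀⟩ : ∃ n, (G j).coeff n ≠ 0 := by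
    by_contra! h
    exact hj (Polynomial.ext h)
  obtain ⟨D, hD⟩ : ∃ D, ∀ i n, D ≤ n → (G i).coeff n = 0 := by
    refine ⟨(Finset.univ.sup fun i => (G i).natDegree) + 1, fun i n hn => ?_⟩
    apply coeff_eq_zero_of_natDegree_lt
    have := Finset.le_sup (f := fun i => (G i).natDegree) (Finset.mem_univ i)
    omega
  have hn₀D : n₀ < D := by
    by_contra! h
    exact hn₀ (hD j n₀ h)
  obtain ⟨⟨k, m⟩, -, hkm⟩ := Finset.exists_max_image
    ((Finset.univ : Finset (Fin g)) ×ˢ Finset.range D)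
    (fun q => ‖(G q.1).coeff q.2‖) ⟨(j, n₀), by simpa using hn₀D⟩
  set c := (G k).coeff m with hc
  have hmax : ∀ i n, ‖(G i).coeff n‖ ≤ ‖c‖ := by
    intro i n
    by_cases hn : n < D
    · exact hkm (i, n) (by simpa using hn)
    · rw [hD i n (not_lt.mp hn), norm_zero]
      exact norm_nonneg _
  have hc0 : c ≠ 0 := by
    intro h
    have := hmax j n₀
    rw [h, norm_zero] at this
    exact hn₀ (norm_le_zero_iff.mp this)
  have hlift : ∀ i, ∃ f : ℤ_[p][X], f.map PadicInt.Coe.ringHom = C c⁻¹ * G i := by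
    intro i
    have : C c⁻¹ * G i ∈ lifts (PadicInt.Coe.ringHom (p := p)) := by
      rw [lifts_iff_coeff_lifts]
      intro n
      refine ⟨⟨(C c⁻¹ * G i).coeff n, ?_⟩, rfl⟩
      rw [coeff_C_mul, norm_mul, norm_inv, inv_mul_le_iff₀ (norm_pos_iff.mpr hc0), mul_one]
      exact hmax i n
    exact this
  choose F hF using hlift
  have hGF : ∀ i, G i = C c * (F i).map PadicInt.Coe.ringHom := by
    intro i
    rw [hF i, ← mul_assoc, ← C_mul, mul_inv_cancel₀ hc0, C_1, one_mul]
  have hcoeff : ∀ i n, (G i).coeff n = c * ((F i).coeff n : ℤ_[p]) := by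
    intro i n
    conv_lhs => rw [hGF i, coeff_C_mul, coeff_map]
    rfl
  have hm : residueVec (coeffVec F m) ≠ 0 := by
    rw [residueVec_ne_zero_iff]
    refine ⟨k, ?_⟩
    have h1 := hcoeff k m
    rw [← hc] at h1
    have h2 : (((F k).coeff m : ℤ_[p]) : ℚ_[p]) = 1 :=
      mul_left_cancel₀ hc0 (by rw [← h1, mul_one])
    rw [coeffVec, PadicInt.norm_def, h2, norm_one]
  have hbdd : BddAbove {n | residueVec (coeffVec F n) ≠ 0} := by
    refine ⟨D, fun n hn => ?_⟩
    by_contra! h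
    refine hn (funext fun i => ?_)
    have h1 := hcoeff i n
    rw [hD i n h.le] at h1
    have h2 : (F i).coeff n = 0 := by
      apply PadicInt.ext
      rw [PadicInt.coe_zero]
      exact (mul_eq_zero.mp h1.symm).resolve_left hc0
    rw [residueVec, coeffVec, h2, map_zero, Pi.zero_apply]
  refine ⟨c, F, sSup {n | residueVec (coeffVec F n) ≠ 0}, hc0, hcoeff, fun i t => ?_,
    Nat.sSup_mem ⟨m, hm⟩ hbdd, fun n hn => ?_⟩
  · rw [hGF i, eval_mul, eval_C, eval_map]
    congr 1
    exact (hom_eval₂ (F i) (RingHom.id _) PadicInt.Coe.ringHom t).symm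
  · by_contra h
    exact absurd (le_csSup hbdd h) (not_le.mpr hn)

/-- Restriction of a polynomial vector to the residue disk `a + pℤ_p`, rescaled to be primitive.
If the Taylor coefficient of degree `m` at `a` is nonzero modulo `p`, then the reduced degree
drops to at most `m`; in case of equality, the leading coefficient reduces to the same point as
that Taylor coefficient. -/
theorem exists_primitive_on_residue_disk (F : Fin g → ℤ_[p][X]) (a : ℤ_[p]) (m : ℕ)
    (hm : residueVec (coeffVec (fun i => taylor a (F i)) m) ≠ 0) :
    ∃ (c : ℚ_[p]) (F' : Fin g → ℤ_[p][X]) (N : ℕ) (h : HasReducedDegree F' N), c ≠ 0 ∧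
      (∀ s, evalVec F (a + p * s) = c • evalVec F' s) ∧ N ≤ m ∧
      (N = m → h.top = Projectivization.mk (ZMod p) _ hm) := by
  have hp : (p : ℚ_[p]) ≠ 0 := by exact_mod_cast (Fact.out : p.Prime).ne_zero
  set T : Fin g → ℤ_[p][X] := fun i => taylor a (F i) with hT
  set G : Fin g → ℚ_[p][X] := fun i =>
    ((T i).map PadicInt.Coe.ringHom).comp (C (p : ℚ_[p]) * X) with hG
  have hGc : ∀ i n, (G i).coeff n = (p : ℚ_[p]) ^ n * ((T i).coeff n : ℤ_[p]) := by
    intro i n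
    rw [hG, comp_C_mul_X_coeff, coeff_map, mul_comm]
    rfl
  have hGe : ∀ i (s : ℤ_[p]), (G i).eval (s : ℚ_[p]) = ((F i).eval (a + p * s) : ℤ_[p]) := by
    intro i s
    have h1 : (p : ℚ_[p]) * s = PadicInt.Coe.ringHom ((p : ℤ_[p]) * s) := by
      rw [map_mul, map_natCast]
      rfl
    rw [hG, eval_comp, eval_mul, eval_C, eval_X, h1, eval_map, eval₂_at_apply, hT, taylor_eval,
      add_comm]
    rfl
  obtain ⟨i₀, hi₀⟩ := residueVec_ne_zero_iff.mp hm
  have hi₀' : ‖(((T i₀).coeff m : ℤ_[p]) : ℚ_[p])‖ = 1 := hi₀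
  have hG0 : G ≠ 0 := by
    intro h
    have h1 := hGc i₀ m
    rw [h, Pi.zero_apply, coeff_zero] at h1
    have h2 := (mul_eq_zero.mp h1.symm).resolve_left (pow_ne_zero m hp)
    rw [h2, norm_zero] at hi₀'
    exact zero_ne_one hi₀'
  obtain ⟨c, F', N, hc, hcoeff, heval, hN⟩ := exists_primitive G hG0
  -- The scalar `c` has norm at least `‖p ^ m‖`, while the coefficients of `G` of degree greater
  -- than `m` have smaller norm.
  have hNm : N ≤ m := by
    by_contra! hlt
    obtain ⟨k, hk⟩ := residueVec_ne_zero_iff.mp hN.ne_zero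
    have hk' : ‖(((F' k).coeff N : ℤ_[p]) : ℚ_[p])‖ = 1 := hk
    have h1 : ‖c‖ ≤ ‖(p : ℚ_[p]) ^ N‖ := by
      have h := congrArg norm ((hcoeff k N).symm.trans (hGc k N))
      rw [norm_mul, hk', mul_one, norm_mul] at h
      rw [h]
      exact mul_le_of_le_one_right (norm_nonneg _) (PadicInt.norm_le_one _)
    have h2 : ‖(p : ℚ_[p]) ^ m‖ ≤ ‖c‖ := by
      have h := congrArg norm ((hGc i₀ m).symm.trans (hcoeff i₀ m))
      rw [norm_mul, hi₀', mul_one, norm_mul] at h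
      rw [h]
      exact mul_le_of_le_one_right (norm_nonneg _) (PadicInt.norm_le_one _)
    have h3 : ‖(p : ℚ_[p]) ^ N‖ < ‖(p : ℚ_[p]) ^ m‖ := by
      rw [norm_pow, norm_pow]
      exact pow_lt_pow_right_of_lt_one₀ (norm_pos_iff.mpr hp) Padic.norm_p_lt_one hlt
    linarith
  refine ⟨c, F', N, hN, hc, fun s => ?_, hNm, ?_⟩
  · funext i
    rw [Pi.smul_apply, smul_eq_mul]
    exact (hGe i s).symm.trans (heval i s)
  · rintro rfl
    have hrel : coeVec (coeffVec F' N) = (c⁻¹ * (p : ℚ_[p]) ^ N) • coeVec (coeffVec T N) := by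
      funext i
      have h := (hcoeff i N).symm.trans (hGc i N)
      rw [Pi.smul_apply, smul_eq_mul, mul_assoc]
      change (((F' i).coeff N : ℤ_[p]) : ℚ_[p]) = c⁻¹ * ((p : ℚ_[p]) ^ N * ((T i).coeff N : ℤ_[p]))
      rw [← h, inv_mul_cancel_left₀ hc]
    exact mk_residueVec_eq (isPrimitiveRep_coeVec hN.ne_zero).ne_zero hrel
      (isPrimitiveRep_coeVec hN.ne_zero) (isPrimitiveRep_coeVec hm)

end Primitive

/-! ### Counting reductions of a polynomial curve -/

section Counting

variable {p : ℕ} [Fact p.Prime] {g : ℕ}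

theorem residueVec_eval (F : Fin g → ℤ_[p][X]) (t : ℤ_[p]) :
    residueVec (fun i => (F i).eval t)
      = fun i => ((F i).map PadicInt.toZMod).eval (PadicInt.toZMod t) := by
  funext i
  rw [eval_map, eval₂_at_apply]
  rfl

theorem HasReducedDegree.natDegree_map_le {F : Fin g → ℤ_[p][X]} {N : ℕ}
    (h : HasReducedDegree F N) (i : Fin g) :
    ((F i).map (PadicInt.toZMod (p := p))).natDegree ≤ N := by
  rw [natDegree_le_iff_coeff_eq_zero]
  intro n hn
  rw [coeff_map]
  exact congrFun (h.eq_zero n hn) i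

/-- If the reduced degree is `0`, then the curve reduces to a single point. -/
theorem rhoImage_subset_top {F : Fin g → ℤ_[p][X]} (h : HasReducedDegree F 0) (T : Set ℤ_[p]) :
    rhoImage (evalVec F '' T) ⊆ {h.top} := by
  rintro P ⟨_, ⟨t, -, rfl⟩, hx, rfl⟩
  have hres : residueVec (fun i => (F i).eval t) = residueVec (coeffVec F 0) := by
    rw [residueVec_eval]
    funext i
    rw [eq_C_of_natDegree_le_zero (h.natDegree_map_le i), eval_C, coeff_map]
    rfl
  have hne : residueVec (fun i => (F i).eval t) ≠ 0 := hres ▸ h.ne_zero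
  refine (rho_mk hx (isPrimitiveRep_coeVec hne)).trans ?_
  rw [HasReducedDegree.top]
  congr 1

theorem rhoImage_subsingleton {S : Set (Fin g → ℚ_[p])} (hS : S.Subsingleton) :
    (rhoImage S).Subsingleton := by
  rintro _ ⟨x, hx, hx0, rfl⟩ _ ⟨y, hy, hy0, rfl⟩
  obtain rfl := hS hx hy
  rfl

/-- Let `D` be a set of parameters in the residue disk of `a`, all of whose rescaled primitive
curves satisfy the expected bound, and let `m` be the multiplicity of `a`. Then at most `p * m`
reductions differ from the reduction of the Taylor coefficient of degree `m`. -/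
theorem ncard_rhoImage_residue_disk_sdiff_le {D : Set ℤ_[p]}
    (hD : ∀ (F : Fin g → ℤ_[p][X]) (N : ℕ) (h : HasReducedDegree F N),
      (insert h.top (rhoImage (evalVec F '' D))).ncard ≤ p * N + 1)
    (F : Fin g → ℤ_[p][X]) (a : ℤ_[p]) (m : ℕ)
    (hm : residueVec (coeffVec (fun i => taylor a (F i)) m) ≠ 0) :
    (rhoImage (evalVec F '' ((fun s => a + p * s) '' D)) \
      {Projectivization.mk (ZMod p) _ hm}).ncard ≤ p * m := by
  obtain ⟨c, F', N, h, hc, heval, hNm, htop⟩ := exists_primitive_on_residue_disk F a m hm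
  have hsub : rhoImage (evalVec F '' ((fun s => a + p * s) '' D)) ⊆
      rhoImage (evalVec F' '' D) := by
    apply rhoImage_subset_of_smul hc
    rintro _ ⟨_, ⟨s, hs, rfl⟩, rfl⟩
    exact ⟨evalVec F' s, ⟨s, hs, rfl⟩, heval s⟩
  have hbound := hD F' N h
  rcases hNm.eq_or_lt with rfl | hlt
  · -- The removed point is the top point of the rescaled curve, so one is saved.
    rw [← htop rfl]
    have h1 : (rhoImage (evalVec F '' ((fun s => a + p * s) '' D)) \ {h.top}).ncard ≤
        (insert h.top (rhoImage (evalVec F' '' D)) \ {h.top}).ncard :=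
      Set.ncard_le_ncard (Set.sdiff_subset_sdiff_left (hsub.trans (Set.subset_insert _ _)))
        (Set.toFinite _)
    rw [Set.ncard_sdiff_singleton_of_mem (Set.mem_insert _ _)] at h1
    omega
  · have h1 : (rhoImage (evalVec F '' ((fun s => a + p * s) '' D)) \
        {Projectivization.mk (ZMod p) _ hm}).ncard ≤
        (insert h.top (rhoImage (evalVec F' '' D))).ncard :=
      Set.ncard_le_ncard (Set.sdiff_subset.trans (hsub.trans (Set.subset_insert _ _)))
        (Set.toFinite _)
    have h2 : p * (N + 1) ≤ p * m := Nat.mul_le_mul_left p hlt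
    have h3 := (Fact.out : p.Prime).one_le
    rw [mul_add, mul_one] at h2
    omega

/-- The reductions of the values of a primitive polynomial vector of reduced degree `N`, together
with its top point, number at most `p * N + 1`. The induction is on a power of `p` that separates
the parameters. -/
theorem ncard_insert_top_rhoImage_le (k : ℕ) (T : Set ℤ_[p])
    (hT : ∀ s ∈ T, ∀ t ∈ T, (p : ℤ_[p]) ^ k ∣ s - t → s = t)
    (F : Fin g → ℤ_[p][X]) (N : ℕ) (h : HasReducedDegree F N) :
    (insert h.top (rhoImage (evalVec F '' T))).ncard ≤ p * N + 1 := by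
  induction k generalizing T F N with
  | zero =>
    have hTs : T.Subsingleton := fun s hs t ht => hT s hs t ht (by simp)
    rcases Nat.eq_zero_or_pos N with rfl | hN
    · have : insert h.top (rhoImage (evalVec F '' T)) ⊆ {h.top} :=
        Set.insert_subset rfl (rhoImage_subset_top h T)
      simpa using Set.ncard_le_ncard this (Set.toFinite _)
    · have h1 := Set.ncard_insert_le h.top (rhoImage (evalVec F '' T))
      have h2 : (rhoImage (evalVec F '' T)).ncard ≤ 1 :=
        Set.ncard_le_one_iff_subsingleton.mpr (rhoImage_subsingleton (hTs.image _))
      have h3 : 1 * 1 ≤ p * N := Nat.mul_le_mul (Fact.out : p.Prime).one_le hN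
      omega
  | succ k ih =>
    have hp : (p : ℤ_[p]) ≠ 0 := by exact_mod_cast (Fact.out : p.Prime).ne_zero
    set u : Fin g → (ZMod p)[X] := fun i => (F i).map PadicInt.toZMod with hu
    have hu0 : u ≠ 0 := by
      intro h0
      refine h.ne_zero (funext fun i => ?_)
      have := congrArg (fun f : (ZMod p)[X] => f.coeff N) (congrFun h0 i)
      simp only [hu, coeff_map, Pi.zero_apply, coeff_zero] at this
      exact this
    obtain ⟨s, v, hs, hv⟩ := exists_eq_prod_X_sub_C_mul u hu0
    have hv' : ∀ a, (fun i => (v i).eval a) ≠ 0 := fun a => Function.ne_iff.mpr (hv a)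
    set Q : ZMod p → ℙ (ZMod p) (Fin g → ZMod p) :=
      fun a => Projectivization.mk (ZMod p) _ (hv' a) with hQ
    set D : ZMod p → Set ℤ_[p] := fun a => {x | (a.val : ℤ_[p]) + p * x ∈ T} with hD
    set A : ZMod p → Set (ℙ (ZMod p) (Fin g → ZMod p)) := fun a =>
      rhoImage (evalVec F '' ((fun x => (a.val : ℤ_[p]) + p * x) '' D a)) with hA
    have hval : ∀ a : ZMod p, PadicInt.toZMod ((a.val : ℕ) : ℤ_[p]) = a := by
      intro a
      rw [map_natCast, ZMod.natCast_zmod_val]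
    -- Each residue disk contributes at most `p` times its multiplicity, apart from `Q a`.
    have hAcard : ∀ a, (A a \ {Q a}).ncard ≤ p * s.count a := by
      intro a
      obtain ⟨c, hc, hcoeff⟩ := exists_coeff_taylor_prod_X_sub_C_mul s a
      have hres : residueVec (coeffVec (fun i => taylor (a.val : ℤ_[p]) (F i)) (s.count a))
          = c • fun i => (v i).eval a := by
        funext i
        rw [Pi.smul_apply, smul_eq_mul, ← hcoeff, ← hs i]
        conv_rhs => rw [← hval a]
        rw [hu, ← map_taylor, coeff_map, hval]
        rfl
      have hne : residueVec (coeffVec (fun i => taylor (a.val : ℤ_[p]) (F i)) (s.count a)) ≠ 0 := by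
        rw [hres]
        exact smul_ne_zero hc (hv' a)
      have hQa : Q a = Projectivization.mk (ZMod p) _ hne := by
        rw [hQ, Projectivization.mk_eq_mk_iff']
        exact ⟨c⁻¹, by rw [hres, inv_smul_smul₀ hc]⟩
      rw [hQa]
      refine ncard_rhoImage_residue_disk_sdiff_le (fun F' N' h' => ih (D a) ?_ F' N' h') F _ _ hne
      intro x hx y hy hxy
      have hdvd : (p : ℤ_[p]) ^ (k + 1) ∣
          ((a.val : ℤ_[p]) + p * x) - ((a.val : ℤ_[p]) + p * y) := by
        rw [add_sub_add_left_eq_sub, ← mul_sub, pow_succ']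
        exact mul_dvd_mul_left _ hxy
      exact mul_left_cancel₀ hp (add_left_cancel (hT _ hx _ hy hdvd))
    have hcover : rhoImage (evalVec F '' T) ⊆ Set.range Q ∪ ⋃ a ∈ Finset.univ, (A a \ {Q a}) := by
      rintro P ⟨_, ⟨t, ht, rfl⟩, hx, hP⟩
      set a := PadicInt.toZMod t with ha
      have hdvd : (p : ℤ_[p]) ∣ t - a.val := by
        rw [← PadicInt.norm_lt_one_iff_dvd, ← toZMod_eq_zero_iff, map_sub, hval, sub_self]
      obtain ⟨x, hx'⟩ := hdvd
      have htx : (a.val : ℤ_[p]) + p * x = t := by rw [← hx']; ring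
      have hPA : P ∈ A a := by
        refine ⟨_, ⟨t, ⟨x, ?_, htx⟩, rfl⟩, hx, hP⟩
        change _ ∈ T
        rw [htx]
        exact ht
      by_cases hPQ : P = Q a
      · exact Or.inl ⟨a, hPQ.symm⟩
      · exact Or.inr (Set.mem_biUnion (Finset.mem_univ a) ⟨hPA, hPQ⟩)
    have hsum : (⋃ a ∈ Finset.univ, (A a \ {Q a})).ncard ≤ p * s.card := by
      refine (Finset.set_ncard_biUnion_le _ _).trans ?_
      refine (Finset.sum_le_sum fun a _ => hAcard a).trans ?_
      rw [← Finset.mul_sum, Multiset.sum_count_eq_card (fun a _ => Finset.mem_univ a)]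
    -- The common factor has degree `s.card`, so that `v` has degree `N - s.card`.
    have hmonic : (s.map fun a => X - C a).prod.Monic :=
      monic_multiset_prod_of_monic _ _ fun a _ => monic_X_sub_C a
    have hdeg : ∀ i, v i ≠ 0 → s.card + (v i).natDegree ≤ N := by
      intro i hi
      rw [← natDegree_multiset_prod_X_sub_C_eq_card s, ← hmonic.natDegree_mul' hi, ← hs i]
      exact h.natDegree_map_le i
    have hcard : s.card ≤ N := by
      obtain ⟨i, hi⟩ := hv 0
      have := hdeg i (by rintro h0; simp [h0] at hi)
      omega
    rcases hcard.eq_or_lt with heq | hlt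
    · -- Now `v` is constant, and all the points `Q a` coincide with the top point.
      have hQtop : ∀ a, Q a = h.top := by
        intro a
        have hva : (fun i => (v i).eval a) = residueVec (coeffVec F N) := by
          funext i
          have hvi : (v i).natDegree ≤ 0 := by
            by_cases hi : v i = 0
            · simp [hi]
            · have := hdeg i hi
              omega
          have h1 : residueVec (coeffVec F N) i = (u i).coeff N := (coeff_map _ _).symm
          rw [h1, hs i, eq_C_of_natDegree_le_zero hvi, eval_C, coeff_mul_C, ← heq,
            ← natDegree_multiset_prod_X_sub_C_eq_card s, hmonic.coeff_natDegree, one_mul]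
        simp only [hQ, HasReducedDegree.top, hva]
      have hsub : insert h.top (rhoImage (evalVec F '' T)) ⊆
          insert h.top (⋃ a ∈ Finset.univ, (A a \ {Q a})) := by
        refine Set.insert_subset (Set.mem_insert _ _) (hcover.trans ?_)
        rintro P (⟨a, rfl⟩ | hP)
        · exact Or.inl (hQtop a)
        · exact Or.inr hP
      have h1 := Set.ncard_le_ncard hsub (Set.toFinite _)
      have h2 := Set.ncard_insert_le h.top (⋃ a ∈ Finset.univ, (A a \ {Q a}))
      rw [heq] at hsum
      omega
    · have h1 := Set.ncard_le_ncard (Set.insert_subset_insert (a := h.top) hcover) (Set.toFinite _)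
      have h2 := Set.ncard_insert_le h.top (Set.range Q ∪ ⋃ a ∈ Finset.univ, (A a \ {Q a}))
      have h3 := Set.ncard_union_le (Set.range Q) (⋃ a ∈ Finset.univ, (A a \ {Q a}))
      have h4 : (Set.range Q).ncard ≤ p := by
        rw [← Set.image_univ]
        refine (Set.ncard_image_le (Set.toFinite _)).trans ?_
        rw [Set.ncard_univ, Nat.card_zmod]
      have h5 : p * (s.card + 1) ≤ p * N := Nat.mul_le_mul_left p hlt
      rw [mul_add, mul_one] at h5
      omega

/-- A finite set of `p`-adic integers is separated by some power of `p`. -/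
theorem exists_pow_separating {T : Set ℤ_[p]} (hT : T.Finite) :
    ∃ k : ℕ, ∀ s ∈ T, ∀ t ∈ T, (p : ℤ_[p]) ^ k ∣ s - t → s = t := by
  have hpair : ∀ q : ℤ_[p] × ℤ_[p], ∃ k : ℕ, (p : ℤ_[p]) ^ k ∣ q.1 - q.2 → q.1 = q.2 := by
    intro q
    by_cases hq : q.1 = q.2
    · exact ⟨0, fun _ => hq⟩
    · obtain ⟨n, hn⟩ := FiniteMultiplicity.of_not_isUnit
        (PadicInt.prime_p (p := p)).not_isUnit (sub_ne_zero.mpr hq)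
      exact ⟨n + 1, fun h => absurd h hn⟩
  choose κ hκ using hpair
  refine ⟨(hT.toFinset ×ˢ hT.toFinset).sup κ, fun s hs t ht hdvd => hκ (s, t) ?_⟩
  refine (pow_dvd_pow _ (Finset.le_sup (f := κ) (b := (s, t)) ?_)).trans hdvd
  simpa using ⟨hs, ht⟩

end Counting

/-! ### Lowest vertices of the Newton polygon -/

section Newton

variable {p : ℕ} [Fact p.Prime] {g : ℕ}

theorem exists_valuation_min {w : Fin g → PowerSeries ℚ_[p]} (hw : w ≠ 0)
    (hbdd : ∃ B : ℝ, ∀ (i : Fin g) (n : ℕ), ‖PowerSeries.coeff n (w i)‖ ≤ B) :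
    ∃ (j : Fin g) (m : ℕ), PowerSeries.coeff m (w j) ≠ 0 ∧
      ∀ (i : Fin g) (n : ℕ), PowerSeries.coeff n (w i) ≠ 0 →
        (PowerSeries.coeff m (w j)).valuation ≤ (PowerSeries.coeff n (w i)).valuation := by
  obtain ⟨B, hB⟩ := hbdd
  obtain ⟨j, hj⟩ := Function.ne_iff.mp hw
  obtain ⟨n, hn⟩ : ∃ n, PowerSeries.coeff n (w j) ≠ 0 := by
    by_contra! h
    exact hj (PowerSeries.ext h)
  have hp1 : (1 : ℝ) < p := by exact_mod_cast (Fact.out : p.Prime).one_lt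
  obtain ⟨K, hK⟩ := pow_unbounded_of_one_lt B hp1
  obtain ⟨v, ⟨i, m, hm, rfl⟩, hv⟩ := Int.exists_least_of_bdd
    (P := fun z : ℤ => ∃ (i : Fin g) (m : ℕ), PowerSeries.coeff m (w i) ≠ 0 ∧
      (PowerSeries.coeff m (w i)).valuation = z)
    ⟨-(K : ℤ), by
      rintro z ⟨i, m, hm, rfl⟩
      have h1 := (hB i m).trans_lt hK
      rw [Padic.norm_eq_zpow_neg_valuation hm, ← zpow_natCast, zpow_lt_zpow_iff_right₀ hp1] at h1
      omega⟩
    ⟨_, j, n, hn, rfl⟩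
  exact ⟨i, m, hm, fun i' n' h' => hv _ ⟨i', n', h', rfl⟩⟩

/-- The points above the height `m`, together with those at height `m` and with abscissa at
least `n`, form a convex set. -/
theorem convex_lex_upper (n m : ℝ) :
    Convex ℝ {Q : ℝ × ℝ | m < Q.2 ∨ (Q.2 = m ∧ n ≤ Q.1)} := by
  rintro ⟨x₁, y₁⟩ h₁ ⟨x₂, y₂⟩ h₂ a b ha hb hab
  simp only [Set.mem_ofPred_eq, Prod.smul_mk, smul_eq_mul, Prod.mk_add_mk] at h₁ h₂ ⊢
  obtain rfl : b = 1 - a := by linarith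
  rcases ha.eq_or_lt with rfl | ha
  · simpa using h₂
  rcases hb.eq_or_lt with hb | hb
  · obtain rfl : a = 1 := by linarith
    simpa using h₁
  rcases h₁ with h₁ | ⟨rfl, h₁⟩
  · left
    have : m ≤ y₂ := by
      rcases h₂ with h₂ | ⟨rfl, -⟩ <;> linarith
    nlinarith
  · rcases h₂ with h₂ | ⟨rfl, h₂⟩
    · left
      nlinarith
    · right
      constructor
      · ring
      · nlinarith

/-- The lowest vertices of the Newton polygon exist, and they come from coefficients of minimal
valuation. -/
theorem lowestAbscissae_spec {w : Fin g → PowerSeries ℚ_[p]} {j : Fin g} {k : ℕ}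
    (hk : PowerSeries.coeff k (w j) ≠ 0)
    (hmin : ∀ (i : Fin g) (n : ℕ), PowerSeries.coeff n (w i) ≠ 0 →
      (PowerSeries.coeff k (w j)).valuation ≤ (PowerSeries.coeff n (w i)).valuation) :
    (lowestAbscissae w).Nonempty ∧ ∀ n ∈ lowestAbscissae w, ∃ i : Fin g,
      PowerSeries.coeff n (w i) ≠ 0 ∧
      (PowerSeries.coeff n (w i)).valuation = (PowerSeries.coeff k (w j)).valuation := by
  classical
  set m := (PowerSeries.coeff k (w j)).valuation with hm
  have hex : ∃ n, ∃ i : Fin g, PowerSeries.coeff n (w i) ≠ 0 ∧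
      (PowerSeries.coeff n (w i)).valuation = m := ⟨k, j, hk, rfl⟩
  set n₀ := Nat.find hex with hn₀
  obtain ⟨i₀, hi₀, hi₀m⟩ := Nat.find_spec hex
  have hgen : ∀ Q ∈ {Q : ℝ × ℝ | ∃ P ∈ newtonPoints w, Q.1 = P.1 ∧ P.2 ≤ Q.2},
      (m : ℝ) < Q.2 ∨ (Q.2 = m ∧ ∃ n : ℕ, Q.1 = n ∧ n₀ ≤ n ∧ ∃ i : Fin g,
        PowerSeries.coeff n (w i) ≠ 0 ∧ (PowerSeries.coeff n (w i)).valuation = m) := by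
    rintro Q ⟨_, ⟨i, n, hin, rfl⟩, h1, h2⟩
    rw [or_iff_not_imp_left, not_lt]
    intro hle
    have h3 : (m : ℝ) ≤ ((PowerSeries.coeff n (w i)).valuation : ℝ) := by
      exact_mod_cast hmin i n hin
    have h4 : (PowerSeries.coeff n (w i)).valuation = m := by
      have : ((PowerSeries.coeff n (w i)).valuation : ℝ) = m := le_antisymm (h2.trans hle) h3
      exact_mod_cast this
    exact ⟨le_antisymm hle (h3.trans h2), n, h1, Nat.find_min' hex ⟨i, hin, h4⟩, i, hin, h4⟩
  have hregion : newtonRegion w ⊆ {Q : ℝ × ℝ | (m : ℝ) < Q.2 ∨ (Q.2 = m ∧ (n₀ : ℝ) ≤ Q.1)} := by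
    refine convexHull_min (fun Q hQ => ?_) (convex_lex_upper _ _)
    rcases hgen Q hQ with h | ⟨h, n, hn, hle, -⟩
    · exact Or.inl h
    · refine Or.inr ⟨h, ?_⟩
      rw [hn]
      exact_mod_cast hle
  have hlow : ∀ Q ∈ newtonRegion w, (m : ℝ) ≤ Q.2 := by
    intro Q hQ
    rcases hregion hQ with h | ⟨h, -⟩
    · exact h.le
    · exact h.ge
  have hvertex : ((n₀ : ℝ), (m : ℝ)) ∈ newtonVertices w := by
    refine mem_extremePoints.mpr ⟨subset_convexHull _ _
      ⟨_, ⟨i₀, n₀, hi₀, rfl⟩, rfl, by simp [hi₀m, n₀]⟩, ?_⟩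
    rintro ⟨x₁, y₁⟩ h₁ ⟨x₂, y₂⟩ h₂ ⟨a, b, ha, hb, hab, heq⟩
    have e1 := congrArg Prod.fst heq
    have e2 := congrArg Prod.snd heq
    simp only [Prod.smul_mk, smul_eq_mul, Prod.mk_add_mk] at e1 e2
    have l₁ := hlow _ h₁
    have l₂ := hlow _ h₂
    simp only at l₁ l₂
    obtain rfl : b = 1 - a := by linarith
    have hy₁ : y₁ = m := by nlinarith
    have hy₂ : y₂ = m := by nlinarith
    have hx₁ : (n₀ : ℝ) ≤ x₁ := by
      rcases hregion h₁ with h | ⟨-, h⟩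
      · exact absurd hy₁ h.ne'
      · exact h
    have hx₂ : (n₀ : ℝ) ≤ x₂ := by
      rcases hregion h₂ with h | ⟨-, h⟩
      · exact absurd hy₂ h.ne'
      · exact h
    have hx₁' : x₁ = n₀ := by nlinarith
    have hx₂' : x₂ = n₀ := by nlinarith
    exact ⟨by rw [hx₁', hy₁], by rw [hx₂', hy₂]⟩
  refine ⟨⟨n₀, m, hvertex, fun Q hQ => hlow Q hQ.1⟩, ?_⟩
  rintro n ⟨y, hy, hymin⟩
  have hym : y ≤ m := hymin _ hvertex
  rcases hgen _ (extremePoints_convexHull_subset hy) with h | ⟨-, n', hn', -, h⟩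
  · exact absurd h (not_lt.mpr hym)
  · obtain rfl : n = n' := Nat.cast_injective (R := ℝ) hn'
    exact h

theorem norm_coeff_le_of_valuation_eq_min {w : Fin g → PowerSeries ℚ_[p]} {j : Fin g} {k : ℕ}
    (hk : PowerSeries.coeff k (w j) ≠ 0)
    (hmin : ∀ (i : Fin g) (n : ℕ), PowerSeries.coeff n (w i) ≠ 0 →
      (PowerSeries.coeff k (w j)).valuation ≤ (PowerSeries.coeff n (w i)).valuation)
    (i : Fin g) (n : ℕ) :
    ‖PowerSeries.coeff n (w i)‖ ≤ ‖PowerSeries.coeff k (w j)‖ := by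
  by_cases h : PowerSeries.coeff n (w i) = 0
  · rw [h, norm_zero]
    exact norm_nonneg _
  · have hp1 : (1 : ℝ) ≤ p := by exact_mod_cast (Fact.out : p.Prime).one_le
    rw [Padic.norm_eq_zpow_neg_valuation h, Padic.norm_eq_zpow_neg_valuation hk]
    exact zpow_le_zpow_right₀ hp1 (neg_le_neg (hmin i n h))

end Newton

/-! ### The integrated series -/

section Integral

variable {p : ℕ} [Fact p.Prime] {g : ℕ}

theorem norm_natCast_eq_zpow {n : ℕ} (hn : n ≠ 0) :
    ‖(n : ℚ_[p])‖ = (p : ℝ) ^ (-(padicValNat p n : ℤ)) := by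
  rw [Padic.norm_eq_zpow_neg_valuation (by exact_mod_cast hn), Padic.valuation_natCast]

theorem one_le_natCast_mul_norm {n : ℕ} (hn : n ≠ 0) : 1 ≤ (n : ℝ) * ‖(n : ℚ_[p])‖ := by
  have hp : (0 : ℝ) < p := by exact_mod_cast (Fact.out : p.Prime).pos
  rw [norm_natCast_eq_zpow hn, zpow_neg, zpow_natCast, ← div_eq_mul_inv,
    one_le_div (pow_pos hp _)]
  exact_mod_cast Nat.le_of_dvd (Nat.pos_of_ne_zero hn) pow_padicValNat_dvd

/-- Beyond `n + δ(p, n)`, division by the exponent cannot make up for the decay of the powers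
of `p`. -/
theorem norm_pow_div_lt {n e : ℕ} (h : n + delta p n < e) :
    ‖(p : ℚ_[p]) ^ (e + 1) / ((e + 1 : ℕ) : ℚ_[p])‖
      < ‖(p : ℚ_[p]) ^ (n + 1) / ((n + 1 : ℕ) : ℚ_[p])‖ := by
  have hp1 : (1 : ℝ) < p := by exact_mod_cast (Fact.out : p.Prime).one_lt
  have hp0 : (p : ℝ) ≠ 0 := by positivity
  obtain ⟨d, rfl⟩ : ∃ d, e = n + d := ⟨e - n, by omega⟩
  have hd : padicValNat p (n + d + 1) < padicValNat p (n + 1) + d := by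
    by_contra! hle
    have := (delta_isGreatest p n).2 hle
    omega
  rw [norm_div, norm_div, norm_natCast_eq_zpow (by omega), norm_natCast_eq_zpow (by omega),
    Padic.norm_p_pow, Padic.norm_p_pow, ← zpow_sub₀ hp0, ← zpow_sub₀ hp0,
    zpow_lt_zpow_iff_right₀ hp1]
  omega

theorem coeff_succ_eq_div {f h : PowerSeries ℚ_[p]} (hf : PowerSeries.derivative ℚ_[p] f = h)
    (n : ℕ) : PowerSeries.coeff (n + 1) f = PowerSeries.coeff n h / ((n + 1 : ℕ) : ℚ_[p]) := by
  rw [← hf, PowerSeries.coeff_derivative]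
  push_cast
  rw [mul_div_cancel_right₀]
  exact_mod_cast Nat.succ_ne_zero n

/-- A primitive of a power series with bounded coefficients converges on `pℤ_p`. -/
theorem summable_coeff_mul_pow {f h : PowerSeries ℚ_[p]}
    (hf : PowerSeries.derivative ℚ_[p] f = h) {B : ℝ}
    (hB : ∀ n, ‖PowerSeries.coeff n h‖ ≤ B) {τ : ℚ_[p]} (hτ : ‖τ‖ < 1) :
    Summable fun n : ℕ => PowerSeries.coeff n f * τ ^ n := by
  have hB0 : 0 ≤ B := (norm_nonneg _).trans (hB 0)
  rw [← summable_nat_add_iff 1]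
  have hs : Summable fun n : ℕ => B * (((n + 1 : ℕ) : ℝ) ^ 1 * ‖τ‖ ^ (n + 1)) :=
    ((summable_nat_add_iff 1).mpr (summable_pow_mul_geometric_of_norm_lt_one 1
      (r := ‖τ‖) (by rwa [norm_norm]))).mul_left B
  refine Summable.of_norm_bounded hs fun n => ?_
  have h1 := one_le_natCast_mul_norm (p := p) (Nat.succ_ne_zero n)
  have h2 : 0 < ‖((n + 1 : ℕ) : ℚ_[p])‖ :=
    norm_pos_iff.mpr (by exact_mod_cast Nat.succ_ne_zero n)
  rw [coeff_succ_eq_div hf, norm_mul, norm_div, norm_pow, pow_one, ← mul_assoc]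
  refine mul_le_mul_of_nonneg_right ?_ (by positivity)
  rw [div_le_iff₀ h2, mul_assoc]
  exact (hB n).trans (le_mul_of_one_le_right hB0 h1)

theorem norm_p_mul_lt_one (a : ℤ_[p]) : ‖(p : ℚ_[p]) * (a : ℚ_[p])‖ < 1 := by
  rw [norm_mul]
  exact (mul_le_of_le_one_right (norm_nonneg _) (PadicInt.norm_le_one a)).trans_lt
    Padic.norm_p_lt_one

/-- A bound for the number of reductions of a curve given by convergent power series: if some
coefficient of degree `k` of `f(p a)` dominates all coefficients of degree greater than `M`, then
there are at most `p * M + 1` reductions. -/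
theorem encard_rhoImage_evalSeries_le (l : Fin g → PowerSeries ℚ_[p])
    (hsum : ∀ τ ∈ pZp p, ∀ i, Summable fun n : ℕ => PowerSeries.coeff n (l i) * τ ^ n)
    {M k : ℕ} {j : Fin g}
    (hdom : ∀ i n, M < n → ‖PowerSeries.coeff n (l i) * (p : ℚ_[p]) ^ n‖
      < ‖PowerSeries.coeff k (l j) * (p : ℚ_[p]) ^ k‖) :
    (rhoImage (evalSeries l '' pZp p)).encard ≤ ((p * M + 1 : ℕ) : ℕ∞) := by
  set S := rhoImage (evalSeries l '' pZp p) with hS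
  have hrep : ∀ P : S, ∃ (a : ℤ_[p]) (hx : evalSeries l ((p : ℚ_[p]) * a) ≠ 0),
      rho (Projectivization.mk ℚ_[p] _ hx) = P := by
    rintro ⟨_, _, ⟨_, ⟨a, rfl⟩, rfl⟩, hx, rfl⟩
    exact ⟨a, hx, rfl⟩
  choose a hx ha using hrep
  set G : ℕ → Fin g → Polynomial ℚ_[p] := fun D i =>
    PowerSeries.trunc D (PowerSeries.rescale (p : ℚ_[p]) (l i)) with hG
  have hGcoeff : ∀ D i n, (G D i).coeff n =
      if n < D then PowerSeries.coeff n (l i) * (p : ℚ_[p]) ^ n else 0 := by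
    intro D i n
    rw [hG, PowerSeries.coeff_trunc, PowerSeries.coeff_rescale, mul_comm]
  have hGlim : ∀ (P : S) i, Filter.Tendsto (fun D => (G D i).eval (a P : ℚ_[p])) Filter.atTop
      (nhds (evalSeries l ((p : ℚ_[p]) * a P) i)) := by
    intro P i
    have h := (hsum _ ⟨a P, rfl⟩ i).hasSum.tendsto_sum_nat
    refine h.congr fun D => ?_
    rw [hG, Polynomial.eval, PowerSeries.eval₂_trunc_eq_sum_range]
    refine Finset.sum_congr rfl fun n _ => ?_
    rw [PowerSeries.coeff_rescale, RingHom.id_apply, mul_pow]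
    ring
  -- A truncation of high degree has the same reductions at the chosen parameters.
  have hclose : ∀ P : S, ∀ᶠ D in Filter.atTop,
      ∃ hx' : (fun i => (G D i).eval (a P : ℚ_[p])) ≠ 0,
        rho (Projectivization.mk ℚ_[p] _ hx') = P := by
    intro P
    obtain ⟨i, hi⟩ := Function.ne_iff.mp (hx P)
    have hall : ∀ᶠ D in Filter.atTop, ∀ i', ‖(G D i').eval (a P : ℚ_[p])
        - evalSeries l ((p : ℚ_[p]) * a P) i'‖ < ‖evalSeries l ((p : ℚ_[p]) * a P) i‖ := by
      rw [Filter.eventually_all]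
      intro i'
      have := (tendsto_iff_norm_sub_tendsto_zero.mp (hGlim P i'))
      exact this.eventually_lt_const (norm_pos_iff.mpr hi)
    filter_upwards [hall] with D hD
    obtain ⟨hx', h⟩ := exists_rho_eq_of_close (x' := fun i => (G D i).eval (a P : ℚ_[p]))
      (hx P) ⟨i, hD⟩
    exact ⟨hx', h.trans (ha P)⟩
  obtain ⟨D, hDk, hD⟩ := ((Filter.eventually_gt_atTop k).and
    (Filter.eventually_all.mpr hclose)).exists
  have hck : PowerSeries.coeff k (l j) * (p : ℚ_[p]) ^ k ≠ 0 :=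
    norm_pos_iff.mp ((norm_nonneg _).trans_lt (hdom j (M + 1) (Nat.lt_succ_self M)))
  have hG0 : G D ≠ 0 := by
    intro h
    have h1 := hGcoeff D j k
    rw [if_pos hDk, h, Pi.zero_apply, Polynomial.coeff_zero] at h1
    exact hck h1.symm
  obtain ⟨c, F, N, hc, hcoeff, heval, hN⟩ := exists_primitive (G D) hG0
  have hNM : N ≤ M := by
    by_contra! hlt
    obtain ⟨i, hi⟩ := residueVec_ne_zero_iff.mp hN.ne_zero
    have hi' : ‖(((F i).coeff N : ℤ_[p]) : ℚ_[p])‖ = 1 := hi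
    have h1 := hGcoeff D j k
    rw [if_pos hDk, hcoeff] at h1
    have h2 : ‖PowerSeries.coeff k (l j) * (p : ℚ_[p]) ^ k‖ ≤ ‖c‖ := by
      rw [← h1, norm_mul]
      exact mul_le_of_le_one_right (norm_nonneg _) (PadicInt.norm_le_one _)
    have h3 : ‖c‖ = ‖(G D i).coeff N‖ := by rw [hcoeff, norm_mul, hi', mul_one]
    have h4 := hdom i N hlt
    rw [hGcoeff] at h3
    split_ifs at h3 with hND
    · linarith
    · rw [norm_zero] at h3
      exact hc (norm_eq_zero.mp h3)
  obtain ⟨e, he⟩ := exists_pow_separating (Set.finite_range a)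
  have hbound := ncard_insert_top_rhoImage_le e (Set.range a) he F N hN
  have hsub : S ⊆ insert hN.top (rhoImage (evalVec F '' Set.range a)) := by
    intro P hP
    refine Or.inr ?_
    obtain ⟨hx', h⟩ := hD ⟨P, hP⟩
    refine rhoImage_subset_of_smul (S := {fun i => (G D i).eval (a ⟨P, hP⟩ : ℚ_[p])}) hc ?_
      ⟨_, rfl, hx', h⟩
    rintro _ rfl
    exact ⟨_, ⟨_, ⟨⟨P, hP⟩, rfl⟩, rfl⟩, funext fun i => heval i _⟩
  rw [← (Set.toFinite S).cast_ncard_eq]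
  have h1 := Set.ncard_le_ncard hsub (Set.toFinite _)
  have h2 : p * N ≤ p * M := Nat.mul_le_mul_left p hNM
  exact_mod_cast (by omega : S.ncard ≤ p * M + 1)

end Integral

end PadicCurve

end

theorem mainTheorem12 (p : ℕ) [Fact p.Prime] (g : ℕ)
    (w : Fin g → PowerSeries ℚ_[p]) (hw : w ≠ 0)
    (hbdd : ∃ B : ℝ, ∀ (i : Fin g) (n : ℕ), ‖PowerSeries.coeff n (w i)‖ ≤ B)
    (l : Fin g → PowerSeries ℚ_[p])
    (hl : ∀ i : Fin g, PowerSeries.derivative ℚ_[p] (l i) = w i) :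
    (∀ τ ∈ PadicCurve.pZp p, ∀ i : Fin g,
      Summable fun n : ℕ => PowerSeries.coeff n (l i) * τ ^ n) ∧
    (PadicCurve.lowestAbscissae w).Nonempty ∧
    (PadicCurve.rhoImage (PadicCurve.evalSeries l '' PadicCurve.pZp p)).encard ≤
      ((p * (PadicCurve.newtonMin w + 1 + PadicCurve.delta p (PadicCurve.newtonMin w)) + 1 : ℕ) :
        ℕ∞) := by
  obtain ⟨j, k, hk, hmin⟩ := PadicCurve.exists_valuation_min hw hbdd
  obtain ⟨hne, hspec⟩ := PadicCurve.lowestAbscissae_spec hk hmin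
  have hsum : ∀ τ ∈ PadicCurve.pZp p, ∀ i : Fin g,
      Summable fun n : ℕ => PowerSeries.coeff n (l i) * τ ^ n := by
    obtain ⟨B, hB⟩ := hbdd
    rintro _ ⟨a, rfl⟩ i
    exact PadicCurve.summable_coeff_mul_pow (hl i) (hB i) (PadicCurve.norm_p_mul_lt_one a)
  refine ⟨hsum, hne, ?_⟩
  obtain ⟨i₀, hi₀, hval⟩ := hspec _ (Nat.sInf_mem hne)
  set n := PadicCurve.newtonMin w with hn
  change PowerSeries.coeff n (w i₀) ≠ 0 at hi₀
  have hle := PadicCurve.norm_coeff_le_of_valuation_eq_min hi₀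
    (fun i m hm => hval.trans_le (hmin i m hm))
  -- The coefficient of degree `n + 1` of `l` has been divided by `n + 1`, whence the shift.
  refine PadicCurve.encard_rhoImage_evalSeries_le l hsum (k := n + 1) (j := i₀) fun i m hm => ?_
  obtain ⟨e, rfl⟩ : ∃ e, m = e + 1 := ⟨m - 1, by omega⟩
  rw [PadicCurve.coeff_succ_eq_div (hl i), PadicCurve.coeff_succ_eq_div (hl i₀), div_mul_eq_mul_div,
    div_mul_eq_mul_div, mul_div_assoc, mul_div_assoc, norm_mul, norm_mul]
  exact mul_lt_mul' (hle i e) (PadicCurve.norm_pow_div_lt (by omega)) (norm_nonneg _)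
    (norm_pos_iff.mpr hi₀)
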